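/- Let $m\in\{1,2,\dots\}\cup\{\infty\}$, write $\mathbb Z_m=\mathbb Z/m\mathbb Z$ for $m<\infty$ and $\mathbb Z_\infty=\mathbb Z$, and let $\mathfrak g^{\mathbb C}=\bigoplus_{i\in\mathbb Z_m}\mathfrak g_i^{\mathbb C}$ be a finite-dimensional complex $\mathbb Z_m$-graded Lie algebra which is simple as a graded Lie algebra (non-abelian, without homogeneous ideals other than $0$ and $\mathfrak g^{\mathbb C}$). Let $\theta\in\operatorname{Aut}(\mathfrak g^{\mathbb C})$ be the automorphism defining the grading: $\theta(x)=\omega^i x$ for $x\in\mathfrak g_i^{\mathbb C}$, where $\omega$ is a primitive $m$-th root of unity if $m<\infty$ and $\omega=2$ if $m=\infty$. Let $\mathfrak g$ be a real form of the Lie algebra $\mathfrak g^{\mathbb C}$, with complex conjugation $\sigma$, such that the cyclic group $\langle\theta\rangle$ is defined over $\mathbb R$, i.e. $\sigma\langle\theta\rangle\sigma^{-1}=\langle\theta\rangle$. Let $\Gamma=\operatorname{Gal}(\mathbb C/\mathbb R)=\{1,\gamma\}$ act on $\operatorname{Aut}(\mathfrak g^{\mathbb C})$ by ${}^\gamma g=\sigma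 g\sigma^{-1}$, and let $\mathcal N^*=\mathcal N^*_{\operatorname{Aut}(\mathfrak g^{\mathbb C})}(\langle\theta\rangle)$ be the ($\Gamma$-stable) subgroup of those elements $g$ of the normalizer of $\langle\theta\rangle$ for which $g\theta g^{-1}$ generates $\langle\theta\rangle$. For a $\Gamma$-group $A$ let $H^1A$ be the set of all $z\in A$ with $z\cdot{}^\gamma z=1$ modulo $z\sim c^{-1}z\,{}^\gamma c$ ($c\in A$), pointed by the class of $1$; the kernel of a map of pointed sets is the preimage of the base point. A real form of $(\mathfrak g^{\mathbb C},\theta)$ (with underlying real Lie algebra $\mathfrak g$) is a real form of $\mathfrak g^{\mathbb C}$ that is isomorphic to $\mathfrak g$ as a real Lie algebra and whose complex conjugation $\tau$ satisfies $\tau\langle\theta\rangle\tau^{-1}=\langle\theta\rangle$; two of them are isomorphic if there is an isomorphism of real Lie algebras between them whose complex linear extension lies in $\mathcal N^*$. Then: (1) $\tau\mapsto[\tau\sigma]$ induces a bijection from the set of isomorphism classes of real forms of $(\mathfrak g^{\mathbb C},\theta)$ onto $$\ker\bigl[H^1\mathcal N^*_{\operatorname{Aut}(\mathfrak g^{\mathbb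 C})}(\langle\theta\rangle)\to H^1\operatorname{Aut}(\mathfrak g^{\mathbb C})\bigr].$$ (2) Equivalently, in terms of $\mathfrak g$ itself: let $Y=\{g\langle\theta\rangle g^{-1}: g\in\operatorname{Aut}(\mathfrak g^{\mathbb C})\}$, and call $H\in Y$ a real point if $\sigma H\sigma^{-1}=H$. Then $g\langle\theta\rangle g^{-1}\mapsto[g^{-1}\cdot{}^\gamma g]$ induces a bijection from the set of $\operatorname{Aut}(\mathfrak g^{\mathbb C})^{\Gamma}$-conjugacy classes of real points of $Y$ onto the same kernel. -/

import Mathlib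

/-! ## First cohomology of a group with an action of `Gal(ℂ/ℝ)` -/

/-- An action of `Γ = Gal(ℂ/ℝ) = {1, γ}` on a group `A` by automorphisms, given by the action of the
complex conjugation `γ`, which is an involutive automorphism of `A`. -/
structure GammaAction (A : Type*) [Group A] where
  /-- the action of `γ` -/
  conj : A →* A
  conj_conj : ∀ a, conj (conj a) = a

namespace GammaAction

variable {A : Type*} [Group A]

/-- `1`-cocycles of `Γ` with values in `A`: a cocycle `c` is determined by `z = c γ`, subject to
`z * γ(z) = 1` (and `c 1 = 1`). -/
def Cocycle (s : GammaAction A) : Type _ := {z : A // z * s.conj z = 1}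

/-- Cohomologous cocycles: `w = c⁻¹ * z * γ(c)` for some `c` in `A`. -/
def cohomologous (s : GammaAction A) : Setoid s.Cocycle where
  r z w := ∃ c : A, w.1 = c⁻¹ * z.1 * s.conj c
  iseqv :=
    { refl := fun z => ⟨1, by simp⟩
      symm := by
        rintro z w ⟨c, h⟩
        exact ⟨c⁻¹, by rw [h]; simp [mul_assoc]⟩
      trans := by
        rintro z w v ⟨c, h⟩ ⟨d, k⟩
        exact ⟨c * d, by rw [k, h]; simp [mul_assoc]⟩ }

/-- The pointed set `H¹(Γ, A)`. -/
def H1 (s : GammaAction A) : Type _ := Quotient s.cohomologous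

/-- The class of a cocycle. -/
def H1.mk (s : GammaAction A) (z : s.Cocycle) : s.H1 := Quotient.mk s.cohomologous z

/-- The neutral element of `H¹`, the class of the trivial cocycle. -/
def H1.neutral (s : GammaAction A) : s.H1 := H1.mk s ⟨1, by simp⟩

/-- The induced action on a `Γ`-stable subgroup. -/
def restrict (s : GammaAction A) (B : Subgroup A) (hB : ∀ b ∈ B, s.conj b ∈ B) :
    GammaAction B where
  conj :=
    { toFun := fun b => ⟨s.conj b, hB b b.2⟩
      map_one' := by ext; simp
      map_mul' := fun a b => by ext; simp }
  conj_conj := fun b => by ext; exact s.conj_conj b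

/-- The map `H¹(Γ, B) → H¹(Γ, A)` induced by the inclusion of a `Γ`-stable subgroup `B` of `A`. -/
def H1.inclusion (s : GammaAction A) (B : Subgroup A) (hB : ∀ b ∈ B, s.conj b ∈ B) :
    (s.restrict B hB).H1 → s.H1 :=
  Quotient.map' (s₁ := (s.restrict B hB).cohomologous) (s₂ := s.cohomologous)
    (fun z => ⟨(z.1 : A), congrArg Subtype.val z.2⟩)
    (by
      rintro z w ⟨c, h⟩
      exact ⟨(c : A), congrArg Subtype.val h⟩)

/-- `ker [H¹(Γ, B) → H¹(Γ, A)]`. -/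
def H1.kernel (s : GammaAction A) (B : Subgroup A) (hB : ∀ b ∈ B, s.conj b ∈ B) :
    Set (s.restrict B hB).H1 :=
  {x | H1.inclusion s B hB x = H1.neutral s}

end GammaAction

/-! ## Automorphisms, gradings -/

/-- The automorphism group of a complex Lie algebra, under composition. -/
instance lieAutGroup {L : Type*} [LieRing L] [LieAlgebra ℂ L] : Group (L ≃ₗ⁅ℂ⁆ L) where
  mul f g := g.trans f
  one := 1
  inv f := f.symm
  mul_assoc _ _ _ := rfl
  one_mul _ := rfl
  mul_one _ := rfl
  inv_mul_cancel f := by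
    ext x
    exact f.symm_apply_apply x

/-- A `ℤ_m`-grading of a complex Lie algebra; `m = 0` stands for `m = ∞`, i.e. a `ℤ`-grading
(recall `ZMod 0 = ℤ`). -/
structure LieGrading (m : ℕ) (L : Type*) [LieRing L] [LieAlgebra ℂ L] where
  /-- the homogeneous components -/
  component : ZMod m → Submodule ℂ L
  isInternal : DirectSum.IsInternal component
  lie_mem : ∀ {i j : ZMod m} {x y : L},
    x ∈ component i → y ∈ component j → ⁅x, y⁆ ∈ component (i + j)

namespace LieGrading

variable {m : ℕ} {L : Type*} [LieRing L] [LieAlgebra ℂ L]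

/-- A graded Lie algebra is simple if it is not abelian and has no homogeneous ideals other than
`0` and itself. (In particular every grading of a simple Lie algebra is simple.) -/
def IsSimple (G : LieGrading m L) : Prop :=
  ¬ IsLieAbelian L ∧
    ∀ I : LieIdeal ℂ L,
      I.toSubmodule = ⨆ i, I.toSubmodule ⊓ G.component i → I = ⊥ ∨ I = ⊤

/-- `θ` is the automorphism defining the grading: `θ x = ω ^ i x` for `x` of degree `i`, where `ω`
is a primitive `m`-th root of unity if `m` is finite, and `ω = 2` if `m = ∞`. -/
def IsDefinedBy (G : LieGrading m L) (θ : L ≃ₗ⁅ℂ⁆ L) : Prop :=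
  ∃ ω : ℂ, (if m = 0 then ω = 2 else IsPrimitiveRoot ω m) ∧
    ∀ i : ℤ, ∀ x ∈ G.component (i : ZMod m), θ x = ω ^ i • x

end LieGrading

/-- `N*`: the elements of the normalizer of `⟨θ⟩` which conjugate `θ` to a generator of `⟨θ⟩`. -/
def starNormalizer {A : Type*} [Group A] (θ : A) : Subgroup A where
  carrier := {g | g ∈ Subgroup.normalizer (Subgroup.zpowers θ : Set A) ∧
    Subgroup.zpowers (g * θ * g⁻¹) = Subgroup.zpowers θ}
  one_mem' := ⟨Subgroup.one_mem _, by simp⟩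
  mul_mem' := by
    rintro a b ⟨ha, ha'⟩ ⟨hb, hb'⟩
    refine ⟨Subgroup.mul_mem _ ha hb, ?_⟩
    have h := congrArg (Subgroup.map (MulAut.conj a).toMonoidHom) hb'
    simp only [MonoidHom.map_zpowers] at h
    rw [← ha']
    simpa [mul_assoc] using h
  inv_mem' := by
    rintro a ⟨ha, ha'⟩
    refine ⟨Subgroup.inv_mem _ ha, ?_⟩
    have h := congrArg (Subgroup.map (MulAut.conj a⁻¹).toMonoidHom) ha'
    simp only [MonoidHom.map_zpowers] at h
    rw [eq_comm]
    simpa [mul_assoc] using h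

/-! ## Real forms -/

/-- A conjugation of a complex Lie algebra: an antilinear involution preserving the bracket. Its
fixed points are a real form of the Lie algebra, and every real form arises from exactly one
conjugation. -/
structure LieConjugation (L : Type*) [LieRing L] [LieAlgebra ℂ L] where
  /-- the underlying antilinear map -/
  toMap : L →ₛₗ[starRingEnd ℂ] L
  map_lie : ∀ x y, toMap ⁅x, y⁆ = ⁅toMap x, toMap y⁆
  involutive : ∀ x, toMap (toMap x) = x

namespace LieConjugation

variable {L : Type*} [LieRing L] [LieAlgebra ℂ L]

/-- The automorphism `x ↦ σ (g (σ x))`. -/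
def conjAut (σ : LieConjugation L) (g : L ≃ₗ⁅ℂ⁆ L) : L ≃ₗ⁅ℂ⁆ L where
  toFun x := σ.toMap (g (σ.toMap x))
  map_add' x y := by simp
  map_smul' c x := by simp [map_smulₛₗ]
  map_lie' := by
    intro x y
    rw [σ.map_lie, LieEquiv.map_lie, σ.map_lie]
  invFun x := σ.toMap (g.symm (σ.toMap x))
  left_inv x := by simp [σ.involutive]
  right_inv x := by simp [σ.involutive]

/-- The action of `Γ` on `Aut L` determined by a real form: `γ` acts by `g ↦ σ g σ⁻¹`. -/
def gammaAction (σ : LieConjugation L) : GammaAction (L ≃ₗ⁅ℂ⁆ L) where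
  conj :=
    { toFun := σ.conjAut
      map_one' := by
        ext x
        exact σ.involutive x
      map_mul' := fun g h => by
        ext x
        change σ.toMap (g (h (σ.toMap x))) =
          σ.toMap (g (σ.toMap (σ.toMap (h (σ.toMap x)))))
        rw [σ.involutive] }
  conj_conj := fun g => by
    ext x
    change σ.toMap (σ.toMap (g (σ.toMap (σ.toMap x)))) = g x
    rw [σ.involutive, σ.involutive]

/-- The subgroup `H` of `Aut L` is defined over `ℝ`, i.e. preserved by the conjugation. -/
def Preserves (σ : LieConjugation L) (H : Subgroup (L ≃ₗ⁅ℂ⁆ L)) : Prop :=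
  H.map σ.gammaAction.conj = H

/-- If `⟨θ⟩` is defined over `ℝ` then so is `N*`. -/
theorem starNormalizer_stable (σ : LieConjugation L) {θ : L ≃ₗ⁅ℂ⁆ L}
    (h : σ.Preserves (Subgroup.zpowers θ)) :
    ∀ b ∈ starNormalizer θ, σ.gammaAction.conj b ∈ starNormalizer θ := by
  rintro b ⟨hb, hb'⟩
  have key : (Subgroup.zpowers θ).map (MulAut.conj (σ.gammaAction.conj b)).toMonoidHom =
      Subgroup.zpowers θ := by
    have e : (MulAut.conj (σ.gammaAction.conj b)).toMonoidHom.comp σ.gammaAction.conj =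
        σ.gammaAction.conj.comp (MulAut.conj b).toMonoidHom := by
      ext1 g
      simp
    have hb'' : (Subgroup.zpowers θ).map (MulAut.conj b).toMonoidHom = Subgroup.zpowers θ := by
      rw [MonoidHom.map_zpowers]
      simpa using hb'
    conv_lhs => rw [← h]
    rw [Subgroup.map_map, e, ← Subgroup.map_map, hb'', h]
  refine ⟨?_, ?_⟩
  · rw [Subgroup.mem_normalizer_iff]
    intro x
    constructor
    · intro hx
      have : (MulAut.conj (σ.gammaAction.conj b)).toMonoidHom x ∈
          (Subgroup.zpowers θ).map (MulAut.conj (σ.gammaAction.conj b)).toMonoidHom :=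
        Subgroup.mem_map_of_mem _ hx
      rw [key] at this
      simpa using this
    · intro hx
      rw [← key] at hx
      obtain ⟨y, hy, hyx⟩ := hx
      have : y = x := by simpa using hyx
      rwa [← this]
  · rw [MonoidHom.map_zpowers] at key
    simpa using key

section

/-- A complex Lie algebra regarded as a real Lie algebra. -/
@[reducible]
def realLieAlgebra (L : Type*) [LieRing L] [LieAlgebra ℂ L] : LieAlgebra ℝ L where
  toModule := Module.complexToReal L
  lie_smul t x y := lie_smul (t : ℂ) x y

attribute [local instance] realLieAlgebra

/-- The real Lie algebra of fixed points of a conjugation. -/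
def realForm (σ : LieConjugation L) : LieSubalgebra ℝ L where
  carrier := {x | σ.toMap x = x}
  add_mem' := by
    intro a b ha hb
    simp only [Set.mem_ofPred_eq] at *
    rw [map_add, ha, hb]
  zero_mem' := by simp
  smul_mem' := by
    intro c x hx
    simp only [Set.mem_ofPred_eq] at *
    change σ.toMap ((c : ℂ) • x) = (c : ℂ) • x
    rw [map_smulₛₗ, hx, Complex.conj_ofReal]
  lie_mem' := by
    intro a b ha hb
    change σ.toMap ⁅a, b⁆ = ⁅a, b⁆
    rw [σ.map_lie]
    exact congrArg₂ _ ha hb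

/-- The real forms with conjugations `τ` and `σ` are isomorphic as real Lie algebras. -/
def Isomorphic (τ σ : LieConjugation L) : Prop :=
  Nonempty (τ.realForm ≃ₗ⁅ℝ⁆ σ.realForm)

/-- The real forms with conjugations `τ` and `τ'` are isomorphic as real Lie algebras, by an
isomorphism whose complex linear extension to an automorphism of `L` belongs to `N`. -/
def IsomorphicVia (N : Subgroup (L ≃ₗ⁅ℂ⁆ L)) (τ τ' : LieConjugation L) : Prop :=
  ∃ φ : τ.realForm ≃ₗ⁅ℝ⁆ τ'.realForm, ∃ Φ ∈ N, ∀ x : τ.realForm, Φ (x : L) = (φ x : L)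

theorem IsomorphicVia.refl (N : Subgroup (L ≃ₗ⁅ℂ⁆ L)) (τ : LieConjugation L) :
    IsomorphicVia N τ τ :=
  ⟨LieEquiv.refl, 1, N.one_mem, fun _ => rfl⟩

theorem IsomorphicVia.symm {N : Subgroup (L ≃ₗ⁅ℂ⁆ L)} {τ τ' : LieConjugation L}
    (h : IsomorphicVia N τ τ') : IsomorphicVia N τ' τ := by
  obtain ⟨φ, Φ, hΦ, h⟩ := h
  refine ⟨φ.symm, Φ⁻¹, N.inv_mem hΦ, fun x => ?_⟩
  have := h (φ.symm x)
  rw [LieEquiv.apply_symm_apply] at this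
  rw [← this]
  exact Φ.symm_apply_apply _

theorem IsomorphicVia.trans {N : Subgroup (L ≃ₗ⁅ℂ⁆ L)} {τ τ' τ'' : LieConjugation L}
    (h : IsomorphicVia N τ τ') (k : IsomorphicVia N τ' τ'') : IsomorphicVia N τ τ'' := by
  obtain ⟨φ, Φ, hΦ, h⟩ := h
  obtain ⟨ψ, Ψ, hΨ, k⟩ := k
  refine ⟨φ.trans ψ, Ψ * Φ, N.mul_mem hΨ hΦ, fun x => ?_⟩
  change Ψ (Φ x) = _
  rw [h, k]
  rfl

end

end LieConjugation

section

variable {L : Type*} [LieRing L] [LieAlgebra ℂ L]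

/-- The real forms of `(L, θ)` of type `σ`: the real forms of `L` over which the cyclic group `⟨θ⟩`
is defined, and whose underlying real Lie algebra is isomorphic to the one given by `σ`. -/
structure GradedRealForm (σ : LieConjugation L) (θ : L ≃ₗ⁅ℂ⁆ L) where
  /-- the conjugation with respect to the real form -/
  conjugation : LieConjugation L
  preserves : conjugation.Preserves (Subgroup.zpowers θ)
  isomorphic : conjugation.Isomorphic σ

/-- Isomorphism of real forms of `(L, θ)`: an isomorphism of real Lie algebras whose complexification
is an automorphism of `(L, ⟨θ⟩)`. -/
def GradedRealForm.setoid (σ : LieConjugation L) (θ : L ≃ₗ⁅ℂ⁆ L) :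
    Setoid (GradedRealForm σ θ) where
  r τ τ' := LieConjugation.IsomorphicVia (starNormalizer θ) τ.conjugation τ'.conjugation
  iseqv :=
    { refl := fun _ => LieConjugation.IsomorphicVia.refl _ _
      symm := fun h => h.symm
      trans := fun h k => h.trans k }

/-- The real points of the orbit `Y = Aut(L)·⟨θ⟩` of `⟨θ⟩` under conjugation. -/
def RealPoint (σ : LieConjugation L) (θ : L ≃ₗ⁅ℂ⁆ L) : Type _ :=
  {H : Subgroup (L ≃ₗ⁅ℂ⁆ L) //
    (∃ g, H = (Subgroup.zpowers θ).map (MulAut.conj g).toMonoidHom) ∧ σ.Preserves H}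

/-- Two real points are equivalent if they are conjugate under the automorphisms of the real form,
i.e. under the automorphisms of `L` which are fixed by `γ`. -/
def RealPoint.setoid (σ : LieConjugation L) (θ : L ≃ₗ⁅ℂ⁆ L) : Setoid (RealPoint σ θ) where
  r P Q := ∃ a, σ.gammaAction.conj a = a ∧ Q.1 = P.1.map (MulAut.conj a).toMonoidHom
  iseqv :=
    { refl := fun P => ⟨1, map_one _, by
        have : (MulAut.conj (1 : L ≃ₗ⁅ℂ⁆ L)).toMonoidHom = MonoidHom.id _ := by
          ext1 x
          simp
        rw [this, Subgroup.map_id]⟩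
      symm := by
        rintro P Q ⟨a, ha, h⟩
        refine ⟨a⁻¹, by rw [map_inv, ha], ?_⟩
        have : (MulAut.conj a⁻¹).toMonoidHom.comp (MulAut.conj a).toMonoidHom =
            MonoidHom.id _ := by
          ext1 x
          simp [mul_assoc]
        rw [h, Subgroup.map_map, this, Subgroup.map_id]
      trans := by
        rintro P Q R ⟨a, ha, h⟩ ⟨b, hb, k⟩
        refine ⟨b * a, by rw [map_mul, ha, hb], ?_⟩
        have : (MulAut.conj b).toMonoidHom.comp (MulAut.conj a).toMonoidHom =
            (MulAut.conj (b * a)).toMonoidHom := by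
          ext1 x
          simp
        rw [k, h, Subgroup.map_map, this] }

end

/-! Both parts are Galois descent, with `N*` as the stabilizer of `⟨θ⟩` under conjugation
(`mem_starNormalizer_iff`). For (1), a conjugation `τ` is recorded by the complex linear map `z =
τσ`. That `τ` is an involution is the cocycle condition; that `τ` preserves `⟨θ⟩` means `z ∈ N*`,
since `σ` preserves it; and `Φτ = τ'Φ` is the coboundary relation `τσ = Φ⁻¹ (τ'σ) γ(Φ)`
(`intertwines_iff`). An isomorphism of real forms extends complex linearly to such a `Φ`
(`isomorphicVia_iff`, `isomorphic_iff`), so `τ` has the type of `σ` exactly when `z` splits in `Aut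
L`. Conversely a cocycle `z` gives `τ = zσ`. For (2), `Y` is `Aut L / N*`, and the classes of its
real points under the fixed group form the kernel on `H¹`, as in the exact cohomology sequence of a
subgroup (`RealPoint.mk_cocycle_eq_iff`). -/

/-! ## Bijections out of quotients, and elements of `H¹` -/

/-- A surjection whose fibres are the classes of an equivalence relation induces a bijection on the
quotient. -/
theorem Setoid.exists_quotient_equiv {X Y : Type*} (r : Setoid X) (f : X → Y)
    (hf : ∀ x y, f x = f y ↔ r x y) (hs : Function.Surjective f) :
    ∃ F : Quotient r ≃ Y, ∀ x, F (Quotient.mk r x) = f x := by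
  refine ⟨Equiv.ofBijective (Quotient.lift f fun x y h => (hf x y).2 h) ⟨?_, ?_⟩, fun _ => rfl⟩
  · rintro ⟨x⟩ ⟨y⟩ h
    exact Quotient.sound ((hf x y).1 h)
  · intro y
    obtain ⟨x, rfl⟩ := hs y
    exact ⟨Quotient.mk r x, rfl⟩

namespace GammaAction

variable {A : Type*} [Group A] (s : GammaAction A)

theorem H1.mk_eq_mk_iff {z w : s.Cocycle} :
    H1.mk s z = H1.mk s w ↔ ∃ c : A, w.1 = c⁻¹ * z.1 * s.conj c :=
  Quotient.eq (r := s.cohomologous)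

theorem H1.mk_restrict_eq_iff {B : Subgroup A} {hB : ∀ b ∈ B, s.conj b ∈ B}
    {z w : (s.restrict B hB).Cocycle} :
    H1.mk _ z = H1.mk _ w ↔ ∃ c ∈ B, (w.1 : A) = c⁻¹ * z.1 * s.conj c := by
  rw [H1.mk_eq_mk_iff]
  constructor
  · rintro ⟨c, h⟩
    exact ⟨c, c.2, congrArg Subtype.val h⟩
  · rintro ⟨c, hc, h⟩
    exact ⟨⟨c, hc⟩, Subtype.ext h⟩

theorem H1.mk_mem_kernel_iff {B : Subgroup A} {hB : ∀ b ∈ B, s.conj b ∈ B}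
    {z : (s.restrict B hB).Cocycle} :
    H1.mk _ z ∈ H1.kernel s B hB ↔ ∃ c : A, (z.1 : A) = c⁻¹ * s.conj c := by
  -- With the base point on the left, the coboundary relation reads `z = c⁻¹ · 1 · γ(c)`.
  refine Iff.trans (eq_comm.trans (H1.mk_eq_mk_iff s)) (exists_congr fun c => ?_)
  change (z.1 : A) = c⁻¹ * 1 * s.conj c ↔ _
  rw [mul_one]

end GammaAction

/-! ## The group `N*` as a stabilizer -/

section

variable {A : Type*} [Group A]

theorem Subgroup.map_conj_mul (H : Subgroup A) (a b : A) :
    H.map (MulAut.conj (a * b)).toMonoidHom =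
      (H.map (MulAut.conj b).toMonoidHom).map (MulAut.conj a).toMonoidHom := by
  rw [Subgroup.map_map]
  congr 1
  ext1 x
  simp

theorem Subgroup.map_conj_inv_eq_iff {H K : Subgroup A} {a : A} :
    H.map (MulAut.conj a⁻¹).toMonoidHom = K ↔ H = K.map (MulAut.conj a).toMonoidHom := by
  have one (H : Subgroup A) : H.map (MulAut.conj (1 : A)).toMonoidHom = H := by
    convert H.map_id
    ext1 x
    simp
  constructor
  · rintro rfl
    rw [← Subgroup.map_conj_mul, mul_inv_cancel, one]
  · rintro rfl
    rw [← Subgroup.map_conj_mul, inv_mul_cancel, one]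

/-- Conjugation by `g` carries `⟨θ⟩` onto `⟨gθg⁻¹⟩`, so the generator condition alone says that `g`
stabilizes `⟨θ⟩`; it implies the normalizer condition because conjugation is injective. -/
theorem mem_starNormalizer_iff {θ g : A} :
    g ∈ starNormalizer θ ↔
      (Subgroup.zpowers θ).map (MulAut.conj g).toMonoidHom = Subgroup.zpowers θ := by
  have e : Subgroup.zpowers (g * θ * g⁻¹) =
      (Subgroup.zpowers θ).map (MulAut.conj g).toMonoidHom := by
    rw [MonoidHom.map_zpowers]
    simp
  constructor
  · rintro ⟨-, h⟩
    rw [← e, h]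
  · intro h
    refine ⟨?_, e.trans h⟩
    rw [Subgroup.mem_normalizer_iff]
    intro x
    constructor
    · intro hx
      rw [← h]
      exact ⟨x, hx, by simp⟩
    · intro hx
      rw [← h] at hx
      obtain ⟨y, hy, hyx⟩ := hx
      have : y = x := by simpa using hyx
      rwa [← this]

/-- Two elements move `⟨θ⟩` to the same subgroup iff they differ by an element of `N*`. -/
theorem map_conj_zpowers_eq_iff {θ g h : A} :
    (Subgroup.zpowers θ).map (MulAut.conj g).toMonoidHom =
      (Subgroup.zpowers θ).map (MulAut.conj h).toMonoidHom ↔ g⁻¹ * h ∈ starNormalizer θ := by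
  rw [mem_starNormalizer_iff, Subgroup.map_conj_mul, Subgroup.map_conj_inv_eq_iff, eq_comm]

theorem GammaAction.map_conj_map_conj (s : GammaAction A) (H : Subgroup A) (g : A) :
    (H.map (MulAut.conj g).toMonoidHom).map s.conj =
      (H.map s.conj).map (MulAut.conj (s.conj g)).toMonoidHom := by
  rw [Subgroup.map_map, Subgroup.map_map]
  congr 1
  ext1 x
  simp

end

/-! ### Complex linear extension of isomorphisms of real forms -/

namespace LieConjugation

variable {L : Type*} [LieRing L] [LieAlgebra ℂ L]

section Extension

attribute [local instance] realLieAlgebra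

@[simp]
theorem mem_realForm {τ : LieConjugation L} {x : L} : x ∈ τ.realForm ↔ τ.toMap x = x :=
  Iff.rfl

/-- The real part of an element of `L` with respect to a real form. -/
noncomputable def realPart (τ : LieConjugation L) (x : L) : τ.realForm :=
  ⟨(2⁻¹ : ℂ) • (x + τ.toMap x), by
    rw [mem_realForm, map_smulₛₗ, map_add, τ.involutive, add_comm x, map_inv₀, map_ofNat]⟩

/-- The imaginary part of an element of `L` with respect to a real form. -/
noncomputable def imagPart (τ : LieConjugation L) (x : L) : τ.realForm :=
  -- For `x = a + ib`, the real part of `-ix = b - ia` is `b`.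
  τ.realPart (-Complex.I • x)

theorem realPart_add_imagPart (τ : LieConjugation L) (x : L) :
    (τ.realPart x : L) + Complex.I • (τ.imagPart x : L) = x := by
  simp only [realPart, imagPart, map_smulₛₗ, map_neg, Complex.conj_I, smul_add, smul_smul]
  match_scalars <;> ring_nf <;> norm_num

theorem realPart_add (τ : LieConjugation L) (x y : L) :
    τ.realPart (x + y) = τ.realPart x + τ.realPart y := by
  ext
  simp only [realPart, map_add, AddMemClass.coe_add]
  module

theorem realPart_coe (τ : LieConjugation L) (a : τ.realForm) : τ.realPart (a : L) = a := by
  ext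
  have h : τ.toMap (a : L) = a := a.2
  simp only [realPart, h]
  module

theorem realPart_I_smul_coe (τ : LieConjugation L) (a : τ.realForm) :
    τ.realPart (Complex.I • (a : L)) = 0 := by
  ext
  have h : τ.toMap (a : L) = a := a.2
  simp [realPart, h, map_smulₛₗ]

variable {τ σ : LieConjugation L}

/-- The complex linear extension of a map between real forms. -/
noncomputable def complexify (φ : τ.realForm ≃ₗ⁅ℝ⁆ σ.realForm) (x : L) : L :=
  (φ (τ.realPart x) : L) + Complex.I • (φ (τ.imagPart x) : L)

/-- Since the decomposition `a + ib` is unique, any one of them computes `complexify`; its algebraic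
properties are all checked in this form. -/
theorem complexify_add_I_smul (φ : τ.realForm ≃ₗ⁅ℝ⁆ σ.realForm) (a b : τ.realForm) :
    complexify φ ((a : L) + Complex.I • (b : L)) = (φ a : L) + Complex.I • (φ b : L) := by
  have h : -Complex.I • ((a : L) + Complex.I • (b : L)) =
      (b : L) + Complex.I • ((-a : τ.realForm) : L) := by
    simp only [smul_add, smul_smul, NegMemClass.coe_neg]
    match_scalars <;> simp
  rw [complexify, imagPart, h, realPart_add, realPart_add, realPart_coe, realPart_coe,
    realPart_I_smul_coe, realPart_I_smul_coe, add_zero, add_zero]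

theorem exists_add_I_smul (τ : LieConjugation L) (x : L) :
    ∃ a b : τ.realForm, x = (a : L) + Complex.I • (b : L) :=
  ⟨_, _, (τ.realPart_add_imagPart x).symm⟩

theorem complexify_symm_complexify (φ : τ.realForm ≃ₗ⁅ℝ⁆ σ.realForm) (x : L) :
    complexify φ.symm (complexify φ x) = x := by
  obtain ⟨a, b, rfl⟩ := τ.exists_add_I_smul x
  rw [complexify_add_I_smul, complexify_add_I_smul, LieEquiv.symm_apply_apply,
    LieEquiv.symm_apply_apply]

/-- The complex linear extension of an isomorphism of real forms, as an automorphism. -/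
noncomputable def complexifyEquiv (φ : τ.realForm ≃ₗ⁅ℝ⁆ σ.realForm) : L ≃ₗ⁅ℂ⁆ L where
  toFun := complexify φ
  invFun := complexify φ.symm
  left_inv := complexify_symm_complexify φ
  right_inv := complexify_symm_complexify φ.symm
  map_add' x y := by
    obtain ⟨a, b, rfl⟩ := τ.exists_add_I_smul x
    obtain ⟨c, d, rfl⟩ := τ.exists_add_I_smul y
    have h : (a : L) + Complex.I • (b : L) + ((c : L) + Complex.I • (d : L)) =
        ((a + c : τ.realForm) : L) + Complex.I • ((b + d : τ.realForm) : L) := by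
      simp only [AddMemClass.coe_add]
      module
    rw [h, complexify_add_I_smul, complexify_add_I_smul, complexify_add_I_smul]
    simp only [map_add, AddMemClass.coe_add]
    module
  map_smul' z x := by
    obtain ⟨a, b, rfl⟩ := τ.exists_add_I_smul x
    -- Stated for every `ρ` because it is used twice: over `τ` before applying `φ`, over `σ` after.
    have key (ρ : LieConjugation L) (a b : ρ.realForm) :
        z • ((a : L) + Complex.I • (b : L)) =
          ((z.re • a - z.im • b : ρ.realForm) : L) +
            Complex.I • ((z.im • a + z.re • b : ρ.realForm) : L) := by
      change _ = ((z.re : ℂ) • (a : L) - (z.im : ℂ) • (b : L)) +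
        Complex.I • ((z.im : ℂ) • (a : L) + (z.re : ℂ) • (b : L))
      conv_lhs => rw [← Complex.re_add_im z]
      match_scalars
      · ring
      · linear_combination (z.im : ℂ) * Complex.I_mul_I
    rw [key, complexify_add_I_smul, complexify_add_I_smul, RingHom.id_apply, key]
    simp only [map_add, map_sub, map_smul]
  map_lie' {x y} := by
    obtain ⟨a, b, rfl⟩ := τ.exists_add_I_smul x
    obtain ⟨c, d, rfl⟩ := τ.exists_add_I_smul y
    have key (ρ : LieConjugation L) (a b c d : ρ.realForm) :
        ⁅(a : L) + Complex.I • (b : L), (c : L) + Complex.I • (d : L)⁆ =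
          ((⁅a, c⁆ - ⁅b, d⁆ : ρ.realForm) : L) +
            Complex.I • ((⁅a, d⁆ + ⁅b, c⁆ : ρ.realForm) : L) := by
      simp only [lie_add, add_lie, lie_smul, smul_lie, AddMemClass.coe_add,
        AddSubgroupClass.coe_sub, LieSubalgebra.coe_bracket]
      match_scalars <;> simp
    change complexify φ _ = ⁅complexify φ _, complexify φ _⁆
    rw [key, complexify_add_I_smul, complexify_add_I_smul, complexify_add_I_smul, key]
    simp only [map_add, map_sub, LieEquiv.map_lie]

theorem complexifyEquiv_coe (φ : τ.realForm ≃ₗ⁅ℝ⁆ σ.realForm) (a : τ.realForm) :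
    complexifyEquiv φ (a : L) = (φ a : L) := by
  change complexify φ (a : L) = _
  simpa using complexify_add_I_smul φ a 0

/-- An isomorphism of real forms with complex linear extension in `N` is the same as an element of
`N` intertwining the conjugations. -/
theorem isomorphicVia_iff {N : Subgroup (L ≃ₗ⁅ℂ⁆ L)} :
    IsomorphicVia N τ σ ↔ ∃ Φ ∈ N, ∀ x, Φ (τ.toMap x) = σ.toMap (Φ x) := by
  constructor
  · rintro ⟨φ, Φ, hΦ, h⟩
    refine ⟨Φ, hΦ, fun x => ?_⟩
    -- Both sides are antilinear in `x` and agree on the real form of `τ`, which spans `L` over `ℂ`.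
    obtain ⟨a, b, rfl⟩ := τ.exists_add_I_smul x
    have ha : τ.toMap (a : L) = a := a.2
    have hb : τ.toMap (b : L) = b := b.2
    have ha' : σ.toMap (φ a : L) = φ a := (φ a).2
    have hb' : σ.toMap (φ b : L) = φ b := (φ b).2
    simp only [map_add, map_smulₛₗ, h, ha, hb, ha', hb']
    rfl
  · rintro ⟨Φ, hΦ, h⟩
    have h' (x : L) : Φ.symm (σ.toMap x) = τ.toMap (Φ.symm x) := by
      rw [← Φ.apply_symm_apply x, ← h]
      simp
    refine ⟨{ toFun := fun x => ⟨Φ x, ?_⟩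
              invFun := fun x => ⟨Φ.symm x, ?_⟩
              left_inv := fun x => Subtype.ext (Φ.symm_apply_apply _)
              right_inv := fun x => Subtype.ext (Φ.apply_symm_apply _)
              map_add' := fun x y => Subtype.ext (map_add Φ _ _)
              map_smul' := fun c x => Subtype.ext (map_smul Φ (c : ℂ) (x : L))
              map_lie' := fun {x y} => Subtype.ext (Φ.map_lie _ _) }, Φ, hΦ, fun _ => rfl⟩
    · have hx : τ.toMap (x : L) = x := x.2
      rw [mem_realForm, ← h, hx]
    · have hx : σ.toMap (x : L) = x := x.2
      rw [mem_realForm, ← h', hx]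

theorem isomorphic_iff :
    Isomorphic τ σ ↔ ∃ Φ : L ≃ₗ⁅ℂ⁆ L, ∀ x, Φ (τ.toMap x) = σ.toMap (Φ x) := by
  have h : Isomorphic τ σ ↔ IsomorphicVia ⊤ τ σ :=
    ⟨fun ⟨φ⟩ => ⟨φ, complexifyEquiv φ, Subgroup.mem_top _, complexifyEquiv_coe φ⟩,
      fun ⟨φ, _⟩ => ⟨φ⟩⟩
  rw [h, isomorphicVia_iff]
  simp

end Extension

/-! ## Conjugations and cocycles -/

/-- The composition of two conjugations, an automorphism of the complex Lie algebra. -/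
def compAut (τ σ : LieConjugation L) : L ≃ₗ⁅ℂ⁆ L where
  toFun x := τ.toMap (σ.toMap x)
  map_add' x y := by simp
  map_smul' c x := by simp [map_smulₛₗ]
  map_lie' := by
    intro x y
    rw [σ.map_lie, τ.map_lie]
  invFun x := σ.toMap (τ.toMap x)
  left_inv x := by simp [σ.involutive, τ.involutive]
  right_inv x := by simp [σ.involutive, τ.involutive]

/-- Here `γ(τσ) = σ(τσ)σ = στ`, the inverse of `τσ`. -/
theorem compAut_mul_conj (τ σ : LieConjugation L) :
    τ.compAut σ * σ.gammaAction.conj (τ.compAut σ) = 1 := by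
  ext x
  change τ.toMap (σ.toMap (σ.toMap (τ.toMap (σ.toMap (σ.toMap x))))) = x
  simp only [σ.involutive, τ.involutive]

theorem map_conj_compAut (τ σ : LieConjugation L) (H : Subgroup (L ≃ₗ⁅ℂ⁆ L)) :
    H.map (MulAut.conj (τ.compAut σ)).toMonoidHom =
      (H.map σ.gammaAction.conj).map τ.gammaAction.conj := by
  rw [Subgroup.map_map]
  congr 1

theorem compAut_mem_starNormalizer_iff {τ σ : LieConjugation L} {θ : L ≃ₗ⁅ℂ⁆ L}
    (hσ : σ.Preserves (Subgroup.zpowers θ)) :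
    τ.compAut σ ∈ starNormalizer θ ↔ τ.Preserves (Subgroup.zpowers θ) := by
  rw [mem_starNormalizer_iff, map_conj_compAut, hσ, Preserves]

/-- Intertwining two conjugations amounts to a coboundary relation. -/
theorem intertwines_iff {τ τ' σ : LieConjugation L} {Φ : L ≃ₗ⁅ℂ⁆ L} :
    (∀ x, Φ (τ.toMap x) = τ'.toMap (Φ x)) ↔
      τ.compAut σ = Φ⁻¹ * τ'.compAut σ * σ.gammaAction.conj Φ := by
  rw [mul_assoc, eq_inv_mul_iff_mul_eq]
  constructor
  · intro h
    ext x
    change Φ (τ.toMap (σ.toMap x)) = τ'.toMap (σ.toMap (σ.toMap (Φ (σ.toMap x))))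
    rw [h, σ.involutive]
  · intro h x
    -- Evaluating at `σ x` cancels the factor `σ` in `compAut`.
    have := DFunLike.congr_fun h (σ.toMap x)
    change Φ (τ.toMap (σ.toMap (σ.toMap x))) =
      τ'.toMap (σ.toMap (σ.toMap (Φ (σ.toMap (σ.toMap x))))) at this
    simpa only [σ.involutive] using this

theorem compAut_self (σ : LieConjugation L) : σ.compAut σ = 1 := by
  ext x
  exact σ.involutive x

/-- The conjugation `zσ` twisted by a cocycle `z`. -/
def twist (σ : LieConjugation L) (z : L ≃ₗ⁅ℂ⁆ L) (hz : z * σ.gammaAction.conj z = 1) :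
    LieConjugation L where
  toMap :=
    { toFun := fun x => z (σ.toMap x)
      map_add' := fun x y => by simp
      map_smul' := fun c x => by simp [map_smulₛₗ] }
  map_lie x y := by
    change z (σ.toMap ⁅x, y⁆) = ⁅z (σ.toMap x), z (σ.toMap y)⁆
    rw [σ.map_lie, LieEquiv.map_lie]
  -- `(zσ)² = z · σzσ = z · γ(z)`.
  involutive x := DFunLike.congr_fun hz x

theorem twist_compAut (σ : LieConjugation L) (z : L ≃ₗ⁅ℂ⁆ L)
    (hz : z * σ.gammaAction.conj z = 1) : (σ.twist z hz).compAut σ = z := by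
  ext x
  exact congrArg z (σ.involutive x)

end LieConjugation

/-! ### Real forms of `(L, θ)` and their cocycles -/

open GammaAction

section

variable {L : Type*} [LieRing L] [LieAlgebra ℂ L] {θ : L ≃ₗ⁅ℂ⁆ L} {σ : LieConjugation L}
  (hσ : σ.Preserves (Subgroup.zpowers θ))

/-- The cocycle `τσ` of a real form `τ` of `(L, θ)`. -/
def GradedRealForm.cocycle (τ : GradedRealForm σ θ) :
    (σ.gammaAction.restrict (starNormalizer θ) (σ.starNormalizer_stable hσ)).Cocycle :=
  ⟨⟨τ.conjugation.compAut σ,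
    (LieConjugation.compAut_mem_starNormalizer_iff hσ).2 τ.preserves⟩,
    Subtype.ext (τ.conjugation.compAut_mul_conj σ)⟩

theorem GradedRealForm.mk_cocycle_mem_kernel (τ : GradedRealForm σ θ) :
    H1.mk _ (τ.cocycle hσ) ∈
      H1.kernel σ.gammaAction (starNormalizer θ) (σ.starNormalizer_stable hσ) := by
  rw [H1.mk_mem_kernel_iff]
  obtain ⟨Φ, h⟩ := LieConjugation.isomorphic_iff.1 τ.isomorphic
  have h := (LieConjugation.intertwines_iff (σ := σ)).1 h
  rw [LieConjugation.compAut_self, mul_one] at h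
  exact ⟨Φ, h⟩

theorem GradedRealForm.mk_cocycle_eq_iff (τ τ' : GradedRealForm σ θ) :
    H1.mk _ (τ.cocycle hσ) = H1.mk _ (τ'.cocycle hσ) ↔ GradedRealForm.setoid σ θ τ τ' := by
  -- An intertwiner from `τ` to `τ'` expresses `τσ` through `τ'σ`, hence the swap.
  rw [eq_comm, H1.mk_restrict_eq_iff]
  refine Iff.trans ?_ LieConjugation.isomorphicVia_iff.symm
  exact exists_congr fun Φ => and_congr_right fun _ => LieConjugation.intertwines_iff.symm

/-- The cocycle itself, not only its class, is attained, by `τ = zσ`; a splitting `z = c⁻¹ γ(c)`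
makes `c` an isomorphism from `τ` to `σ`. -/
theorem GradedRealForm.exists_cocycle_eq
    (z : (σ.gammaAction.restrict (starNormalizer θ) (σ.starNormalizer_stable hσ)).Cocycle)
    (hz : H1.mk _ z ∈
      H1.kernel σ.gammaAction (starNormalizer θ) (σ.starNormalizer_stable hσ)) :
    ∃ τ : GradedRealForm σ θ, τ.cocycle hσ = z := by
  rw [H1.mk_mem_kernel_iff] at hz
  obtain ⟨c, hc⟩ := hz
  have hz : (z.1 : L ≃ₗ⁅ℂ⁆ L) * σ.gammaAction.conj z.1 = 1 := congrArg Subtype.val z.2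
  have e := σ.twist_compAut z.1 hz
  refine ⟨⟨σ.twist z.1 hz, ?_, ?_⟩, ?_⟩
  · rw [← LieConjugation.compAut_mem_starNormalizer_iff hσ, e]
    exact z.1.2
  · refine LieConjugation.isomorphic_iff.2 ⟨c, ?_⟩
    rw [LieConjugation.intertwines_iff (σ := σ), e, LieConjugation.compAut_self, mul_one, hc]
  · exact Subtype.ext (Subtype.ext e)

/-! ### Real points of the orbit and their cocycles -/

/-- If `g` moves `⟨θ⟩` to `H`, then `H` is a real point iff `g⁻¹ γ(g)` belongs to `N*`. -/
theorem LieConjugation.preserves_map_conj_iff (hσ : σ.Preserves (Subgroup.zpowers θ))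
    (g : L ≃ₗ⁅ℂ⁆ L) :
    σ.Preserves ((Subgroup.zpowers θ).map (MulAut.conj g).toMonoidHom) ↔
      g⁻¹ * σ.gammaAction.conj g ∈ starNormalizer θ := by
  rw [LieConjugation.Preserves, GammaAction.map_conj_map_conj, hσ, eq_comm,
    map_conj_zpowers_eq_iff]

/-- The cocycle `g⁻¹ γ(g)` of an element `g` moving `⟨θ⟩` to a real point. -/
def RealPoint.cocycle (P : RealPoint σ θ) (g : L ≃ₗ⁅ℂ⁆ L)
    (hg : P.1 = (Subgroup.zpowers θ).map (MulAut.conj g).toMonoidHom) :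
    (σ.gammaAction.restrict (starNormalizer θ) (σ.starNormalizer_stable hσ)).Cocycle :=
  ⟨⟨g⁻¹ * σ.gammaAction.conj g,
    (LieConjugation.preserves_map_conj_iff hσ g).1 (hg ▸ P.2.2)⟩,
    Subtype.ext (by
      change g⁻¹ * σ.gammaAction.conj g * σ.gammaAction.conj (g⁻¹ * σ.gammaAction.conj g) = 1
      rw [map_mul, map_inv, σ.gammaAction.conj_conj]
      group)⟩

theorem RealPoint.mk_cocycle_mem_kernel (P : RealPoint σ θ) (g : L ≃ₗ⁅ℂ⁆ L)
    (hg : P.1 = (Subgroup.zpowers θ).map (MulAut.conj g).toMonoidHom) :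
    H1.mk _ (P.cocycle hσ g hg) ∈
      H1.kernel σ.gammaAction (starNormalizer θ) (σ.starNormalizer_stable hσ) :=
  (H1.mk_mem_kernel_iff _).2 ⟨g, rfl⟩

theorem RealPoint.mk_cocycle_eq_iff (P Q : RealPoint σ θ) (g h : L ≃ₗ⁅ℂ⁆ L)
    (hg : P.1 = (Subgroup.zpowers θ).map (MulAut.conj g).toMonoidHom)
    (hh : Q.1 = (Subgroup.zpowers θ).map (MulAut.conj h).toMonoidHom) :
    H1.mk _ (P.cocycle hσ g hg) = H1.mk _ (Q.cocycle hσ h hh) ↔ RealPoint.setoid σ θ P Q := by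
  rw [H1.mk_restrict_eq_iff]
  change (∃ c ∈ starNormalizer θ, h⁻¹ * σ.gammaAction.conj h =
      c⁻¹ * (g⁻¹ * σ.gammaAction.conj g) * σ.gammaAction.conj c) ↔
    ∃ a, σ.gammaAction.conj a = a ∧ Q.1 = P.1.map (MulAut.conj a).toMonoidHom
  constructor
  · rintro ⟨c, hc, e⟩
    -- Both `gc` and `h` have the same cocycle, so their quotient is fixed by `γ`; as `c ∈ N*`, it
    -- carries `P` to `Q`.
    refine ⟨h * (g * c)⁻¹, ?_, ?_⟩
    · rw [mul_assoc, inv_mul_eq_iff_eq_mul] at e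
      simp only [map_mul, map_inv, e]
      group
    · rw [hg, hh, ← Subgroup.map_conj_mul, eq_comm, map_conj_zpowers_eq_iff]
      convert hc using 1
      group
  · rintro ⟨a, ha, e⟩
    -- Both `ag` and `h` move `⟨θ⟩` to `Q`, so they differ by an element of `N*`; `ag` has the
    -- cocycle of `g` because `a` is fixed.
    refine ⟨(a * g)⁻¹ * h, ?_, ?_⟩
    · rw [← map_conj_zpowers_eq_iff, Subgroup.map_conj_mul, ← hg, ← hh, e]
    · simp only [map_mul, map_inv, ha]
      group

end

/-! ### The two bijections -/

open GammaAction in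
theorem mainTheorem5 {L : Type*} [LieRing L] [LieAlgebra ℂ L] [FiniteDimensional ℂ L]
    (m : ℕ) (G : LieGrading m L) (hG : G.IsSimple)
    (θ : L ≃ₗ⁅ℂ⁆ L) (hθ : G.IsDefinedBy θ)
    (σ : LieConjugation L) (hσ : σ.Preserves (Subgroup.zpowers θ)) :
    (∃ F : Quotient (GradedRealForm.setoid σ θ) ≃
        H1.kernel σ.gammaAction (starNormalizer θ) (σ.starNormalizer_stable hσ),
      ∀ τ : GradedRealForm σ θ,
        ∃ z : (σ.gammaAction.restrict (starNormalizer θ) (σ.starNormalizer_stable hσ)).Cocycle,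
          (∀ x, (z.1 : L ≃ₗ⁅ℂ⁆ L) x = τ.conjugation.toMap (σ.toMap x)) ∧
          (F (Quotient.mk _ τ)).1 = H1.mk _ z) ∧
    (∃ F : Quotient (RealPoint.setoid σ θ) ≃
        H1.kernel σ.gammaAction (starNormalizer θ) (σ.starNormalizer_stable hσ),
      ∀ P : RealPoint σ θ, ∀ g : L ≃ₗ⁅ℂ⁆ L,
        P.1 = (Subgroup.zpowers θ).map (MulAut.conj g).toMonoidHom →
        ∃ z : (σ.gammaAction.restrict (starNormalizer θ) (σ.starNormalizer_stable hσ)).Cocycle,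
          (z.1 : L ≃ₗ⁅ℂ⁆ L) = g⁻¹ * σ.gammaAction.conj g ∧
          (F (Quotient.mk _ P)).1 = H1.mk _ z) := by
  constructor
  · obtain ⟨F, hF⟩ := (GradedRealForm.setoid σ θ).exists_quotient_equiv
      (Y := H1.kernel σ.gammaAction (starNormalizer θ) (σ.starNormalizer_stable hσ))
      (fun τ => ⟨H1.mk _ (τ.cocycle hσ), τ.mk_cocycle_mem_kernel hσ⟩)
      (fun τ τ' => Subtype.ext_iff.trans (τ.mk_cocycle_eq_iff hσ τ')) (by
        rintro ⟨⟨z⟩, hz⟩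
        obtain ⟨τ, h⟩ := GradedRealForm.exists_cocycle_eq hσ z hz
        exact ⟨τ, Subtype.ext (congrArg (H1.mk _) h)⟩)
    exact ⟨F, fun τ => ⟨τ.cocycle hσ, fun _ => rfl, congrArg Subtype.val (hF τ)⟩⟩
  -- The choice of `g` is harmless: `mk_cocycle_eq_iff` with `Q = P` shows that all `g` moving `⟨θ⟩`
  -- to `P` give one class.
  · choose g hg using fun P : RealPoint σ θ => P.2.1
    obtain ⟨F, hF⟩ := (RealPoint.setoid σ θ).exists_quotient_equiv
      (Y := H1.kernel σ.gammaAction (starNormalizer θ) (σ.starNormalizer_stable hσ))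
      (fun P => ⟨H1.mk _ (P.cocycle hσ (g P) (hg P)), P.mk_cocycle_mem_kernel hσ _ _⟩)
      (fun P Q => Subtype.ext_iff.trans (P.mk_cocycle_eq_iff hσ Q _ _ _ _)) (by
        rintro ⟨⟨z⟩, hz⟩
        obtain ⟨c, hc⟩ := (H1.mk_mem_kernel_iff _).1 hz
        let P : RealPoint σ θ := ⟨(Subgroup.zpowers θ).map (MulAut.conj c).toMonoidHom, ⟨c, rfl⟩,
          (LieConjugation.preserves_map_conj_iff hσ c).2 (hc ▸ z.1.2)⟩
        have h : P.cocycle hσ c rfl = z := Subtype.ext (Subtype.ext hc.symm)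
        refine ⟨P, Subtype.ext ?_⟩
        exact ((P.mk_cocycle_eq_iff hσ P _ c _ rfl).2 (Setoid.refl' _ P)).trans
          (congrArg (H1.mk _) h))
    refine ⟨F, fun P k hk => ⟨P.cocycle hσ k hk, rfl, ?_⟩⟩
    exact (congrArg Subtype.val (hF P)).trans
      ((P.mk_cocycle_eq_iff hσ P _ _ _ _).2 (Setoid.refl' _ P))
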